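/- Write $\alpha \leq_S^{\mathrm{tot}} \beta$ ($\alpha$ is total Solovay reducible to $\beta$) if there are a rational constant $c>0$ and a total computable function $f\colon \mathbb{Q}\to\mathbb{Q}$ such that for all rationals $q<\beta$ we have $f(q)<\alpha$ and $\alpha-f(q)<c(\beta-q)$. A real is left-c.e. if it is the limit of a computable nondecreasing sequence of rationals. A Schnorr test is a uniformly c.e. sequence $(U_n)_{n\in\mathbb{N}}$ of sets $U_n=\bigcup_{\sigma\in W_n}[\sigma]$, where $W_n\subseteq\{0,1\}^*$ and $[\sigma]=[0.\sigma,\,0.\sigma+2^{-|\sigma|})$, such that the Lebesgue measures satisfy $\mu(U_n)\le 2^{-n}$ and are computable uniformly in $n$. A real is Schnorr random if for every Schnorr test $(U_n)_n$ its fractional part lies outside $\bigcap_n U_n$. Corollary. The Schnorr random left-c.e. reals are closed upwards under total Solovay reducibility: if $\alpha$ is a left-c.e. real that is Schnorr random and $\beta$ is a real with $\alpha \leq_S^{\mathrm{tot}} \beta$, then $\beta$ is Schnorr random. -/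

import Mathlib

namespace TotalSolovay

/-- A rational-valued function is computable if numerator and denominator (in lowest terms) of
its values are computed from the argument. -/
def ComputableToRat {X : Type} [Primcodable X] (f : X → ℚ) : Prop :=
  Computable fun x => ((f x).num, (f x).den)

/-- A total function `f : ℚ → ℚ` is computable: from integers `a`, `b` with `b ≥ 0` one can compute
the numerator and the denominator of `f (a / b)`. (For `b = 0` the fraction is read as `0`, which
has no effect on the notion.) -/
def ComputableRatFun (f : ℚ → ℚ) : Prop :=
  ComputableToRat fun p : ℤ × ℕ => f ((p.1 : ℚ) / (p.2 : ℚ))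

/-- A left-c.e. real: the limit of a computable nondecreasing sequence of rationals. -/
def IsLeftCE (α : ℝ) : Prop :=
  ∃ a : ℕ → ℚ, ComputableToRat a ∧ Monotone a ∧
    Filter.Tendsto (fun n => (a n : ℝ)) Filter.atTop (nhds α)

/-- Total Solovay reducibility of `α` to `β` with respect to the constant `c`. -/
def TotalSolovayReducibleWith (c : ℚ) (α β : ℝ) : Prop :=
  ∃ f : ℚ → ℚ, ComputableRatFun f ∧
    ∀ q : ℚ, (q : ℝ) < β → (f q : ℝ) < α ∧ α - (f q : ℝ) < (c : ℝ) * (β - (q : ℝ))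

/-- Total Solovay reducibility of `α` to `β`. -/
def TotalSolovayReducible (α β : ℝ) : Prop :=
  ∃ c : ℚ, 0 < c ∧ TotalSolovayReducibleWith c α β

/-- The dyadic rational `0.σ` with binary digits `σ` after the point. -/
noncomputable def binaryValue : List Bool → ℝ
  | [] => 0
  | b :: σ => ((if b then 1 else 0) + binaryValue σ) / 2

/-- The basic set determined by a binary string `σ`: the reals in `[0,1)` whose binary expansion
(the one that does not end in `111…`) begins with `σ`, i.e. `[0.σ, 0.σ + 2^{-|σ|})`. -/
noncomputable def cylinder (σ : List Bool) : Set ℝ :=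
  Set.Ico (binaryValue σ) (binaryValue σ + (1 / 2) ^ σ.length)

/-- The union of the basic sets of the strings in the `n`-th section of `W`. -/
noncomputable def testSet (W : Set (ℕ × List Bool)) (n : ℕ) : Set ℝ :=
  ⋃ σ ∈ {σ : List Bool | (n, σ) ∈ W}, cylinder σ

/-- A sequence of reals is uniformly computable: `x n` is computable to within `2^{-k}` by a
dyadic rational, uniformly in `n` and `k`. -/
def UniformlyComputable (x : ℕ → ℝ) : Prop :=
  ∃ g : ℕ → ℕ → ℤ, Computable₂ g ∧ ∀ n k, |x n - (g n k : ℝ) / 2 ^ k| ≤ (1 / 2) ^ k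

/-- A Martin-Löf test, given by a c.e. set `W` of pairs: the sets `testSet W n` are uniformly
c.e. open and the `n`-th one has measure at most `2^{-n}`. -/
structure IsMartinLofTest (W : Set (ℕ × List Bool)) : Prop where
  re : REPred fun p => p ∈ W
  measure_le : ∀ n, (MeasureTheory.volume (testSet W n)).toReal ≤ (1 / 2) ^ n

/-- A Schnorr test: a Martin-Löf test whose members have uniformly computable measures. -/
structure IsSchnorrTest (W : Set (ℕ × List Bool)) : Prop extends IsMartinLofTest W where
  measure_computable :
    UniformlyComputable fun n => (MeasureTheory.volume (testSet W n)).toReal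

/-- A real is Schnorr random if its fractional part (that is, the binary sequence of the digits
after the point) is not captured by any Schnorr test. -/
def IsSchnorrRandom (x : ℝ) : Prop :=
  ∀ W : Set (ℕ × List Bool), IsSchnorrTest W → ∃ n, Int.fract x ∉ testSet W n

end TotalSolovay

/-! A Schnorr test capturing β is turned into one capturing α. Let β lie in a dyadic interval of
length ε = 2^{-(l+K)} with left end point x. Then q = x - ε is strictly below β and β - q < 2ε, so
f(q) < α < f(q) + 2cε. If 2c < 2^K, then α is within 2^{-l} of f(q), so its dyadic interval of level
l is among the few such intervals near f(q). Each interval of the test is therefore replaced by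
these neighbours of f(q), which costs a factor of at most 2^{K+2} in measure; passing from index n
to n + K + 2 absorbs it.

The measures of the new test must also be computable. Since f is total, every interval has an image
that can be computed, including intervals to the right of β. Only maximal intervals of the old test
are mapped: they are disjoint, so those of level above s + K have total measure μ(U) - μ(U_{s+K}),
where U_{s+K} is the part of U covered at level s + K. Hence the images of level above s add at most
2^{K+2} times this tail (`volume_testSet_imageTest_le_add`). As μ(U) is computable, a stage with a
small tail can be found effectively (`uniformlyComputable_image`). -/

namespace TotalSolovay

/-! ### Computable arithmetic, bounded search and enumerations -/

section Computability

variable {X Y : Type*} [Primcodable X] [Primcodable Y]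

theorem Computable.comp₃ {f : ℕ → ℕ → ℕ → Y} {a b c : X → ℕ}
    (hf : Computable fun q : ℕ × ℕ × ℕ => f q.1 q.2.1 q.2.2) (ha : Computable a)
    (hb : Computable b) (hc : Computable c) : Computable fun x => f (a x) (b x) (c x) :=
  Computable.comp (f := fun q : ℕ × ℕ × ℕ => f q.1 q.2.1 q.2.2)
    (g := fun x => (a x, b x, c x)) hf (ha.pair (hb.pair hc))

theorem Computable.natAdd {f g : X → ℕ} (hf : Computable f) (hg : Computable g) :
    Computable fun x => f x + g x :=
  Primrec.nat_add.to_comp.comp hf hg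

theorem Computable.natMul {f g : X → ℕ} (hf : Computable f) (hg : Computable g) :
    Computable fun x => f x * g x :=
  Primrec.nat_mul.to_comp.comp hf hg

theorem Computable.natSub {f g : X → ℕ} (hf : Computable f) (hg : Computable g) :
    Computable fun x => f x - g x :=
  Primrec.nat_sub.to_comp.comp hf hg

theorem Computable.natDiv {f g : X → ℕ} (hf : Computable f) (hg : Computable g) :
    Computable fun x => f x / g x :=
  Primrec.nat_div.to_comp.comp hf hg

theorem primrec_two_pow : Primrec fun n : ℕ => 2 ^ n :=
  (Primrec₂.unpaired'.1 Nat.Primrec.pow).comp (Primrec.const 2) Primrec.id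

theorem Computable.twoPow {f : X → ℕ} (hf : Computable f) : Computable fun x => 2 ^ f x :=
  primrec_two_pow.to_comp.comp hf

theorem Computable.decideLe {f g : X → ℕ} (hf : Computable f) (hg : Computable g) :
    Computable fun x => decide (f x ≤ g x) :=
  Primrec.nat_le.decide.to_comp.comp hf hg

theorem Computable.decideLt {f g : X → ℕ} (hf : Computable f) (hg : Computable g) :
    Computable fun x => decide (f x < g x) :=
  Primrec.nat_lt.decide.to_comp.comp hf hg

theorem Computable.decideEq {f g : X → ℕ} (hf : Computable f) (hg : Computable g) :
    Computable fun x => decide (f x = g x) :=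
  (Primrec.eq (α := ℕ)).decide.to_comp.comp hf hg

theorem Computable.boolAnd {f g : X → Bool} (hf : Computable f) (hg : Computable g) :
    Computable fun x => f x && g x :=
  Primrec.and.to_comp.comp hf hg

theorem Computable.boolNot {f : X → Bool} (hf : Computable f) : Computable fun x => !f x :=
  Primrec.not.to_comp.comp hf

/-- Counting the solutions of a computable condition below a computable bound. -/
theorem Computable.count {p : X → ℕ → Bool} {b : X → ℕ} (hp : Computable₂ p) (hb : Computable b) :
    Computable fun x => Nat.count (fun i => p x i = true) (b x) := by
  have h : Computable₂ fun (x : X) (q : ℕ × ℕ) => q.2 + (p x q.1).toNat :=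
    Computable.natAdd (Computable.snd.comp Computable.snd)
      ((Primrec.dom_bool Bool.toNat).to_comp.comp
        (hp.comp Computable.fst (Computable.fst.comp Computable.snd)))
  refine (Computable.nat_rec hb (Computable.const 0) h).of_eq fun x => ?_
  induction b x with
  | zero => simp
  | succ k ih =>
    simp only [ih, Nat.count_succ]
    cases p x k <;> simp

/-- Bounded existential quantification preserves computability. -/
theorem Computable.existsLt {p : X → ℕ → Bool} {b : X → ℕ} (hp : Computable₂ p)
    (hb : Computable b) : Computable fun x => decide (∃ i < b x, p x i = true) := by
  refine (Computable.decideLt (Computable.const 0) (Computable.count hp hb)).of_eq fun x => ?_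
  rw [decide_eq_decide, ← not_iff_not, not_lt, Nat.le_zero, Nat.count_iff_forall_not]
  simp

/-- The encoding of ℤ sends n to 2n and -(n+1) to 2n+1, so parity reads off the sign and halving the
absolute value. -/
theorem primrec_int_toNat : Primrec Int.toNat := by
  refine ((Primrec.cond Primrec.nat_bodd (Primrec.const 0) Primrec.nat_div2).comp
    Primrec.encode).of_eq fun z => ?_
  cases z with
  | ofNat n =>
    change (bif (2 * n).bodd then 0 else (2 * n).div2) = n
    simp
  | negSucc n =>
    change (bif (2 * n + 1).bodd then 0 else (2 * n + 1).div2) = 0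
    simp

theorem primrec_int_neg_toNat : Primrec fun z : ℤ => (-z).toNat := by
  refine ((Primrec.cond Primrec.nat_bodd (Primrec.succ.comp Primrec.nat_div2)
    (Primrec.const 0)).comp Primrec.encode).of_eq fun z => ?_
  cases z with
  | ofNat n =>
    change (bif (2 * n).bodd then (2 * n).div2.succ else 0) = _
    simp
  | negSucc n =>
    change (bif (2 * n + 1).bodd then (2 * n + 1).div2.succ else 0) = n + 1
    simp

theorem primrec_int_sub_natCast : Primrec₂ fun a b : ℕ => (a : ℤ) - b := by
  refine Primrec.encode_iff.1 (Primrec.of_eq (f := fun p : ℕ × ℕ =>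
      if p.2 ≤ p.1 then 2 * (p.1 - p.2) else 2 * (p.2 - p.1 - 1) + 1) ?_ fun p => ?_)
  · exact Primrec.ite (Primrec.nat_le.comp Primrec.snd Primrec.fst)
      (Primrec.nat_double.comp (Primrec.nat_sub.comp Primrec.fst Primrec.snd))
      (Primrec.nat_double_succ.comp (Primrec.nat_sub.comp
        (Primrec.nat_sub.comp Primrec.snd Primrec.fst) (Primrec.const 1)))
  · obtain ⟨a, b⟩ := p
    dsimp only
    split_ifs with h
    · obtain ⟨k, rfl⟩ := Nat.exists_eq_add_of_le h
      have : ((b + k : ℕ) : ℤ) - b = Int.ofNat k := by simp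
      rw [this, Nat.add_sub_cancel_left]
      rfl
    · obtain ⟨k, rfl⟩ := Nat.exists_eq_add_of_lt (not_le.1 h)
      have : (a : ℤ) - ((a + k + 1 : ℕ) : ℤ) = Int.negSucc k := by
        rw [Int.negSucc_eq]; push_cast; ring
      rw [this, show a + k + 1 - a - 1 = k by omega]
      rfl

theorem Computable.intSub {f g : X → ℕ} (hf : Computable f) (hg : Computable g) :
    Computable fun x => (f x : ℤ) - g x :=
  primrec_int_sub_natCast.to_comp.comp hf hg

theorem Computable.intNatCast {f : X → ℕ} (hf : Computable f) :
    Computable fun x => (f x : ℤ) :=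
  (Computable.intSub hf (Computable.const 0)).of_eq fun x => by simp

/-- A recursively enumerable predicate is the range of a computable partial enumeration. -/
theorem exists_enumeration {p : Y → Prop} (hp : REPred p) :
    ∃ e : ℕ → Option Y, Computable e ∧ ∀ y, p y ↔ ∃ t, e t = some y := by
  obtain ⟨c, hc⟩ := Nat.Partrec.Code.exists_code.1 hp
  -- The number t codes a step bound and an input; `decode₂` rejects numbers that are not the code
  -- of an element.
  let e : ℕ → Option Y := fun t => (Nat.Partrec.Code.evaln t.unpair.1 c t.unpair.2).bind
    fun _ => Encodable.decode₂ Y t.unpair.2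
  have hdom : ∀ y, p y ↔ (c.eval (Encodable.encode y)).Dom := by
    intro y
    rw [hc]
    simp [Part.assert]
  have hev : Computable fun t : ℕ => Nat.Partrec.Code.evaln t.unpair.1 c t.unpair.2 :=
    (Nat.Partrec.Code.primrec_evaln.comp (((Primrec.fst.comp Primrec.unpair).pair
      (Primrec.const c)).pair (Primrec.snd.comp Primrec.unpair))).to_comp
  refine ⟨e, Computable.option_bind hev ((Primrec.decode₂.to_comp.comp
    (Computable.snd.comp (Computable.unpair.comp Computable.fst))).to₂), fun y => ⟨?_, ?_⟩⟩
  · intro h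
    obtain ⟨v, hv⟩ := Part.dom_iff_mem.1 ((hdom y).1 h)
    obtain ⟨k, hk⟩ := Nat.Partrec.Code.evaln_complete.1 hv
    refine ⟨Nat.pair k (Encodable.encode y), ?_⟩
    simp only [e, Nat.unpair_pair, Option.mem_def.1 hk, Option.bind_some, Encodable.encodek₂]
  · rintro ⟨t, ht⟩
    obtain ⟨v, hv, hy⟩ := Option.bind_eq_some_iff.1 ht
    rw [hdom, Encodable.mem_decode₂.1 hy]
    exact Part.dom_iff_mem.2 ⟨v, Nat.Partrec.Code.evaln_sound hv⟩

end Computability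

open MeasureTheory Filter Topology

/-! ### Dyadic intervals and binary strings -/

section Strings

/-- The natural number with binary digits `σ`. -/
def strVal : List Bool → ℕ
  | [] => 0
  | b :: σ => b.toNat * 2 ^ σ.length + strVal σ

/-- The natural number formed by the first `L` binary digits of `x` after the point, for `x` in the
unit interval. -/
noncomputable def digits (L : ℕ) (x : ℝ) : ℕ := ⌊x * 2 ^ L⌋₊

theorem computable_strVal : Computable strVal := by
  refine (Primrec.of_eq (f := fun σ : List Bool => List.recOn (motive := fun _ => ℕ) σ 0
    fun b τ r => b.toNat * 2 ^ τ.length + r) ?_ fun σ => ?_).to_comp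
  · refine Primrec.list_rec (h := fun (_ : List Bool) (q : Bool × List Bool × ℕ) =>
      q.1.toNat * 2 ^ q.2.1.length + q.2.2) Primrec.id (Primrec.const 0) ?_
    have h : Primrec fun q : Bool × List Bool × ℕ => q.1.toNat * 2 ^ q.2.1.length + q.2.2 :=
      Primrec.nat_add.comp (Primrec.nat_mul.comp ((Primrec.dom_bool Bool.toNat).comp Primrec.fst)
        (primrec_two_pow.comp (Primrec.list_length.comp (Primrec.fst.comp Primrec.snd))))
        (Primrec.snd.comp Primrec.snd)
    exact h.comp Primrec.snd
  · induction σ with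
    | nil => rfl
    | cons b τ ih => simp only [strVal, ← ih]

theorem strVal_lt (σ : List Bool) : strVal σ < 2 ^ σ.length := by
  induction σ with
  | nil => simp [strVal]
  | cons b τ ih => cases b <;> simp [strVal, pow_succ] <;> omega

theorem exists_strVal_eq {L v : ℕ} (h : v < 2 ^ L) : ∃ σ, σ.length = L ∧ strVal σ = v := by
  induction L generalizing v with
  | zero => exact ⟨[], rfl, by simp at h; simp [strVal, h]⟩
  | succ L ih =>
    by_cases hv : v < 2 ^ L
    · obtain ⟨σ, h1, h2⟩ := ih hv
      exact ⟨false :: σ, by simp [h1], by simp [strVal, h2]⟩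
    · obtain ⟨σ, h1, h2⟩ := ih (v := v - 2 ^ L) (by rw [pow_succ] at h; omega)
      exact ⟨true :: σ, by simp [h1], by simp [strVal, h2, h1]; omega⟩

theorem binaryValue_eq (σ : List Bool) : binaryValue σ = strVal σ / 2 ^ σ.length := by
  induction σ with
  | nil => simp [binaryValue, strVal]
  | cons b τ ih => cases b <;> simp [binaryValue, strVal, ih] <;> field_simp <;> ring

theorem digits_eq_iff {L i : ℕ} {x : ℝ} (hx : 0 ≤ x) :
    digits L x = i ↔ x ∈ Set.Ico ((i : ℝ) / 2 ^ L) ((i + 1 : ℝ) / 2 ^ L) := by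
  rw [digits, Nat.floor_eq_iff (by positivity), Set.mem_Ico, div_le_iff₀ (by positivity),
    lt_div_iff₀ (by positivity)]

theorem digits_lt {L : ℕ} {x : ℝ} (hx : x ∈ Set.Ico (0 : ℝ) 1) : digits L x < 2 ^ L := by
  have := mul_nonneg hx.1 (by positivity : (0 : ℝ) ≤ 2 ^ L)
  rw [digits, Nat.floor_lt this]
  push_cast
  nlinarith [hx.2, (by positivity : (0 : ℝ) < 2 ^ L)]

theorem digits_div {l s : ℕ} (h : l ≤ s) (x : ℝ) : digits s x / 2 ^ (s - l) = digits l x := by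
  obtain ⟨k, rfl⟩ := Nat.exists_eq_add_of_le h
  have h2 := Nat.floor_div_natCast (x * 2 ^ (l + k)) (2 ^ k)
  rw [Nat.add_sub_cancel_left, digits, ← h2, digits]
  congr 1
  push_cast
  rw [pow_add]
  field_simp

theorem Ico_dyadic_subset {s i : ℕ} (h : i < 2 ^ s) :
    Set.Ico ((i : ℝ) / 2 ^ s) ((i + 1 : ℝ) / 2 ^ s) ⊆ Set.Ico 0 1 := by
  refine Set.Ico_subset_Ico (by positivity) ?_
  rw [div_le_one (by positivity)]
  exact_mod_cast h

theorem mem_cylinder_iff {σ : List Bool} {x : ℝ} :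
    x ∈ cylinder σ ↔ x ∈ Set.Ico (0 : ℝ) 1 ∧ digits σ.length x = strVal σ := by
  have h : cylinder σ = Set.Ico ((strVal σ : ℝ) / 2 ^ σ.length)
      ((strVal σ + 1 : ℝ) / 2 ^ σ.length) := by
    rw [cylinder, binaryValue_eq, one_div_pow, ← add_div]
  rw [h]
  constructor
  · intro hx
    have h01 := Ico_dyadic_subset (strVal_lt σ) hx
    exact ⟨h01, (digits_eq_iff h01.1).2 hx⟩
  · rintro ⟨h01, hx⟩
    exact (digits_eq_iff h01.1).1 hx

theorem mem_testSet_iff {W : Set (ℕ × List Bool)} {n : ℕ} {x : ℝ} : x ∈ testSet W n ↔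
    x ∈ Set.Ico (0 : ℝ) 1 ∧ ∃ σ, (n, σ) ∈ W ∧ digits σ.length x = strVal σ := by
  simp only [testSet, Set.mem_iUnion, Set.mem_ofPred_eq, mem_cylinder_iff, exists_prop]
  tauto

/-- The union of the dyadic intervals of level `s` in the unit interval that satisfy `Q`. -/
def levelSet (s : ℕ) (Q : ℕ → Bool) : Set ℝ :=
  {x | x ∈ Set.Ico (0 : ℝ) 1 ∧ Q (digits s x) = true}

theorem levelSet_eq (s : ℕ) (Q : ℕ → Bool) : levelSet s Q =
    ⋃ i ∈ (Finset.range (2 ^ s)).filter fun i => Q i = true,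
      Set.Ico ((i : ℝ) / 2 ^ s) ((i + 1 : ℝ) / 2 ^ s) := by
  ext x
  simp only [levelSet, Set.mem_ofPred_eq, Set.mem_iUnion, Finset.mem_filter, Finset.mem_range,
    exists_prop]
  constructor
  · rintro ⟨hx, hQ⟩
    exact ⟨_, ⟨digits_lt hx, hQ⟩, (digits_eq_iff hx.1).1 rfl⟩
  · rintro ⟨i, ⟨hi, hQ⟩, hx⟩
    have h01 := Ico_dyadic_subset hi hx
    exact ⟨h01, by rwa [(digits_eq_iff h01.1).2 hx]⟩

theorem measurableSet_levelSet (s : ℕ) (Q : ℕ → Bool) : MeasurableSet (levelSet s Q) := by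
  rw [levelSet_eq]
  exact Finset.measurableSet_biUnion _ fun _ _ => measurableSet_Ico

/-- Measures of finite stages become counts, which are computable when Q is. -/
theorem volume_levelSet (s : ℕ) (Q : ℕ → Bool) :
    volume.real (levelSet s Q) = (Nat.count (fun i => Q i = true) (2 ^ s) : ℝ) / 2 ^ s := by
  rw [levelSet_eq, measureReal_biUnion_finset (h := fun i _ => by simp)]
  · have : ∀ i : ℕ, volume.real (Set.Ico ((i : ℝ) / 2 ^ s) ((i + 1 : ℝ) / 2 ^ s)) = 1 / 2 ^ s := by
      intro i
      rw [Real.volume_real_Ico_of_le (by gcongr; simp)]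
      ring
    simp only [this, Finset.sum_const, nsmul_eq_mul, Nat.count_eq_card_filter_range]
    ring
  · intro i hi j hj hij
    refine Set.disjoint_left.2 fun x hx hx' => hij ?_
    have hi : i < 2 ^ s ∧ Q i = true := by simpa using hi
    have h01 := (Ico_dyadic_subset hi.1 hx).1
    rw [← (digits_eq_iff h01).2 hx, ← (digits_eq_iff h01).2 hx']
  · exact fun _ _ => measurableSet_Ico

theorem subset_unit_of_levelSet (s : ℕ) (Q : ℕ → Bool) : levelSet s Q ⊆ Set.Ico 0 1 :=
  fun _ hx => hx.1

/-- A uniformly c.e. sequence of open sets is given by a decidable family of dyadic intervals that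
is closed under passing to subintervals. -/
theorem exists_decidable_intervals {W : Set (ℕ × List Bool)} (hW : REPred fun p => p ∈ W) :
    ∃ P : ℕ → ℕ → ℕ → Bool, (Computable fun q : ℕ × ℕ × ℕ => P q.1 q.2.1 q.2.2) ∧
      (∀ n i, P n 0 i = false) ∧
      (∀ n L i, P n L (i / 2) = true → P n (L + 1) i = true) ∧
      ∀ n x, x ∈ testSet W n ↔ x ∈ Set.Ico (0 : ℝ) 1 ∧ ∃ L, P n L (digits L x) = true := by
  obtain ⟨e, he, hWe⟩ := exists_enumeration hW
  let R : ℕ × ℕ × ℕ → ℕ × List Bool → Bool := fun q y =>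
    (decide (y.1 = q.1) && decide (y.2.length ≤ q.2.1)) &&
      decide (strVal y.2 = q.2.2 / 2 ^ (q.2.1 - y.2.length))
  let T : ℕ × ℕ × ℕ → ℕ → Bool := fun q t =>
    Option.casesOn (motive := fun _ => Bool) (e t) false (R q)
  have hR : Computable fun z : ((ℕ × ℕ × ℕ) × ℕ) × (ℕ × List Bool) => R z.1.1 z.2 := by
    have hq : Computable fun z : ((ℕ × ℕ × ℕ) × ℕ) × (ℕ × List Bool) => z.1.1 :=
      Computable.fst.comp Computable.fst
    have hl : Computable fun z : ((ℕ × ℕ × ℕ) × ℕ) × (ℕ × List Bool) => z.2.2.length :=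
      Computable.list_length.comp (Computable.snd.comp Computable.snd)
    have hL := (Computable.fst.comp Computable.snd).comp hq
    exact Computable.boolAnd (Computable.boolAnd
      (Computable.decideEq (Computable.fst.comp Computable.snd) (Computable.fst.comp hq))
      (Computable.decideLe hl hL))
      (Computable.decideEq (computable_strVal.comp (Computable.snd.comp Computable.snd))
        (Computable.natDiv ((Computable.snd.comp Computable.snd).comp hq)
          (Computable.twoPow (Computable.natSub hL hl))))
  have hTc : Computable₂ T :=
    Computable.option_casesOn (he.comp Computable.snd) (Computable.const false) hR
  have hT : ∀ n L i t, T (n, L, i) t = true ↔ ∃ σ, e t = some (n, σ) ∧ σ.length ≤ L ∧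
      strVal σ = i / 2 ^ (L - σ.length) := by
    intro n L i t
    simp only [T, R]
    rcases e t with _ | ⟨m, σ⟩
    · simp
    · simp only [Bool.and_eq_true, decide_eq_true_eq, Option.some.injEq, Prod.mk.injEq]
      constructor
      · rintro ⟨⟨rfl, h2⟩, h3⟩
        exact ⟨σ, ⟨rfl, rfl⟩, h2, h3⟩
      · rintro ⟨_, ⟨rfl, rfl⟩, h2, h3⟩
        exact ⟨⟨rfl, h2⟩, h3⟩
  -- The level also bounds the enumeration time. This makes membership decidable, and leaves level 0
  -- empty.
  have hP : Computable fun q : ℕ × ℕ × ℕ => decide (∃ t < q.2.1, T q t = true) :=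
    Computable.existsLt hTc (Computable.fst.comp Computable.snd)
  refine ⟨fun n L i => decide (∃ t < L, T (n, L, i) t = true), hP, by simp, ?_, ?_⟩
  · intro n L i
    simp only [decide_eq_true_eq, hT]
    rintro ⟨t, ht, σ, h1, h2, h3⟩
    refine ⟨t, by omega, σ, h1, by omega, ?_⟩
    rw [h3, Nat.div_div_eq_div_mul, ← pow_succ', Nat.succ_sub h2]
  · intro n x
    rw [mem_testSet_iff]
    refine and_congr_right fun hx => ?_
    simp only [decide_eq_true_eq, hT]
    constructor
    · rintro ⟨σ, hσ, h⟩
      obtain ⟨t, ht⟩ := (hWe _).1 hσ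
      -- The level must exceed the time at which σ appears and be at least its length.
      refine ⟨max (t + 1) σ.length, t, by omega, σ, ht, by omega, ?_⟩
      rw [digits_div (le_max_right _ _), h]
    · rintro ⟨L, t, -, σ, h1, h2, h3⟩
      exact ⟨σ, (hWe _).2 ⟨t, h1⟩, by rw [h3, digits_div h2]⟩

end Strings

/-! ### Limits and approximation of measures -/

section Measure

theorem volume_ne_top_of_subset_unit {E : Set ℝ} (h : E ⊆ Set.Ico 0 1) : volume E ≠ ⊤ :=
  measure_ne_top_of_subset h (by simp)

theorem tendsto_volume_iUnion {E : ℕ → Set ℝ} (hm : Monotone E) (h : ∀ s, E s ⊆ Set.Ico 0 1) :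
    Tendsto (fun s => volume.real (E s)) atTop (𝓝 (volume.real (⋃ s, E s))) :=
  (ENNReal.tendsto_toReal (volume_ne_top_of_subset_unit (Set.iUnion_subset h))).comp
    (tendsto_measure_iUnion_atTop hm)

/-- A sequence of reals is uniformly computable if it can be approximated from below. -/
theorem uniformlyComputable_of_approx {x : ℕ → ℝ} {N lev : ℕ → ℕ → ℕ} (hN : Computable₂ N)
    (hlev : Computable₂ lev) (h : ∀ n k, (N n k : ℝ) / 2 ^ lev n k ≤ x n ∧
      x n ≤ (N n k : ℝ) / 2 ^ lev n k + (1 / 2) ^ (k + 1)) : UniformlyComputable x := by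
  have h2 : Computable fun q : ℕ × ℕ => 2 ^ lev q.1 q.2 := Computable.twoPow hlev
  -- With a = N / 2^lev this is ⌊a·2^k + 1/2⌋. Rounding and approximation each contribute at most
  -- half of 2^{-k}.
  refine ⟨fun n k => (((N n k * 2 ^ (k + 1) + 2 ^ lev n k) / (2 * 2 ^ lev n k) : ℕ) : ℤ), ?_, ?_⟩
  · exact Computable.intNatCast (Computable.natDiv (Computable.natAdd (Computable.natMul hN
      (Computable.twoPow (Computable.natAdd Computable.snd (Computable.const 1)))) h2)
      (Computable.natMul (Computable.const 2) h2))
  · intro n k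
    obtain ⟨h1, h2⟩ := h n k
    set v := (N n k * 2 ^ (k + 1) + 2 ^ lev n k) / (2 * 2 ^ lev n k) with hv
    have hp : 0 < 2 * 2 ^ lev n k := by positivity
    have hv1 : v * (2 * 2 ^ lev n k) ≤ N n k * 2 ^ (k + 1) + 2 ^ lev n k := Nat.div_mul_le_self _ _
    have hv2 : N n k * 2 ^ (k + 1) + 2 ^ lev n k < (v + 1) * (2 * 2 ^ lev n k) :=
      (Nat.div_lt_iff_lt_mul hp).1 (Nat.lt_succ_self _)
    have hv1' : (v : ℝ) * (2 * 2 ^ lev n k) ≤ N n k * 2 ^ (k + 1) + 2 ^ lev n k := by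
      exact_mod_cast hv1
    have hv2' : (N n k : ℝ) * 2 ^ (k + 1) + 2 ^ lev n k < (v + 1) * (2 * 2 ^ lev n k) := by
      exact_mod_cast hv2
    set a : ℝ := (N n k : ℝ) / 2 ^ lev n k with ha
    have haN : (N n k : ℝ) = a * 2 ^ lev n k := by rw [ha]; field_simp
    have hq : (0 : ℝ) < 2 ^ lev n k := by positivity
    have hk : (0 : ℝ) < 2 ^ k := by positivity
    rw [haN] at hv1' hv2'
    have e1 : (v : ℝ) ≤ a * 2 ^ k + 1 / 2 := by
      refine le_of_mul_le_mul_right ?_ hq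
      rw [pow_succ] at hv1'
      linarith
    have e2 : a * 2 ^ k ≤ v + 1 / 2 := by
      refine le_of_mul_le_mul_right ?_ hq
      rw [pow_succ] at hv2'
      linarith
    have e3 : x n * 2 ^ k ≤ a * 2 ^ k + 1 / 2 := by
      have := mul_le_mul_of_nonneg_right h2 hk.le
      have e : ((1 / 2 : ℝ) ^ (k + 1)) * 2 ^ k = 1 / 2 := by
        rw [pow_succ, one_div_pow]; field_simp
      linarith
    have e4 := mul_le_mul_of_nonneg_right h1 hk.le
    change |x n - ((v : ℤ) : ℝ) / 2 ^ k| ≤ _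
    rw [Int.cast_natCast, one_div_pow, abs_le]
    constructor
    · rw [neg_le_sub_iff_le_add, div_le_iff₀ hk, add_mul, one_div_mul_cancel hk.ne']
      linarith
    · rw [sub_le_iff_le_add, ← add_div, le_div_iff₀ hk]
      linarith

end Measure

/-- A decidable family of dyadic intervals: `P n L i` refers to the `i`-th interval of level `L` and
to the `n`-th member of the family; the family is closed under passing to halves. -/
structure IntervalFamily where
  mem : ℕ → ℕ → ℕ → Bool
  computable_mem : Computable fun q : ℕ × ℕ × ℕ => mem q.1 q.2.1 q.2.2
  mem_zero : ∀ n i, mem n 0 i = false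
  mem_succ : ∀ n L i, mem n L (i / 2) = true → mem n (L + 1) i = true

/-! ### Stages and maximal intervals of a test -/

namespace IntervalFamily

variable (P : IntervalFamily)

/-- The number of intervals of level `s` in the `n`-th member. -/
def num (n s : ℕ) : ℕ := Nat.count (fun i => P.mem n s i = true) (2 ^ s)

/-- The part of the `n`-th member that is covered by intervals of level `s`. -/
def stage (n s : ℕ) : Set ℝ := levelSet s (P.mem n s)

/-- The maximal intervals. -/
def maximal (n L i : ℕ) : Bool := P.mem n L i && !P.mem n (L - 1) (i / 2)

theorem computable_num : Computable₂ P.num := by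
  have h : Computable₂ fun (q : ℕ × ℕ) (i : ℕ) => P.mem q.1 q.2 i :=
    Computable.comp₃ P.computable_mem (Computable.fst.comp Computable.fst)
      (Computable.snd.comp Computable.fst) Computable.snd
  exact Computable.count h (Computable.twoPow Computable.snd)

theorem computable_maximal :
    Computable fun q : ℕ × ℕ × ℕ => P.maximal q.1 q.2.1 q.2.2 := by
  have h : Computable fun q : ℕ × ℕ × ℕ => P.mem q.1 (q.2.1 - 1) (q.2.2 / 2) :=
    Computable.comp₃ P.computable_mem Computable.fst
      (Computable.natSub (Computable.fst.comp Computable.snd) (Computable.const 1))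
      (Computable.natDiv (Computable.snd.comp Computable.snd) (Computable.const 2))
  exact Computable.boolAnd P.computable_mem (Computable.boolNot h)

theorem digits_succ_div_two (L : ℕ) (x : ℝ) : digits (L + 1) x / 2 = digits L x := by
  have := digits_div (Nat.le_succ L) x
  simpa using this

theorem monotone_stage (n : ℕ) : Monotone (P.stage n) := by
  refine monotone_nat_of_le_succ fun s x hx => ⟨hx.1, P.mem_succ _ _ _ ?_⟩
  rw [digits_succ_div_two]
  exact hx.2

theorem stage_subset (n s : ℕ) : P.stage n s ⊆ Set.Ico 0 1 := fun _ hx => hx.1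

theorem volume_stage (n s : ℕ) : volume.real (P.stage n s) = (P.num n s : ℝ) / 2 ^ s :=
  volume_levelSet _ _

theorem volume_stage_le (n s : ℕ) :
    volume.real (P.stage n s) ≤ volume.real (⋃ s, P.stage n s) :=
  measureReal_mono (Set.subset_iUnion _ _)
    (volume_ne_top_of_subset_unit (Set.iUnion_subset (P.stage_subset n)))

/-- An interval of the new stage is maximal exactly when its parent is absent, so the maximal
intervals tile the difference of consecutive stages. Sums over levels then telescope. -/
theorem count_maximal_succ (n L : ℕ) :
    (Nat.count (fun i => P.maximal n (L + 1) i = true) (2 ^ (L + 1)) : ℝ) / 2 ^ (L + 1) =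
      volume.real (P.stage n (L + 1)) - volume.real (P.stage n L) := by
  rw [← volume_levelSet, ← measureReal_sdiff (P.monotone_stage n (Nat.le_succ L))
    (measurableSet_levelSet _ _) (volume_ne_top_of_subset_unit (P.stage_subset n _))]
  congr 1
  ext x
  simp only [levelSet, stage, maximal, Set.mem_ofPred_eq, Set.mem_sdiff, Bool.and_eq_true,
    Bool.not_eq_true', Nat.add_sub_cancel, digits_succ_div_two]
  rcases P.mem n L (digits L x) <;> simp
  tauto

/-- This cruder bound starts the telescoping, at level K. -/
theorem count_maximal_le (n L : ℕ) :
    (Nat.count (fun i => P.maximal n L i = true) (2 ^ L) : ℝ) / 2 ^ L ≤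
      volume.real (P.stage n L) := by
  rw [volume_stage, num]
  refine div_le_div_of_nonneg_right (Nat.cast_le.2 ?_) (by positivity)
  refine Nat.count_mono_left fun i _ h => ?_
  simp only [maximal, Bool.and_eq_true] at h
  exact h.1

/-- Every point of the `n`-th member lies in a maximal interval. -/
theorem exists_maximal {n : ℕ} {x : ℝ} (hx : x ∈ ⋃ s, P.stage n s) :
    ∃ L, x ∈ P.stage n L ∧ P.maximal n L (digits L x) = true := by
  classical
  have hx' : ∃ L, x ∈ P.stage n L := Set.mem_iUnion.1 hx
  have h1 := Nat.find_spec hx'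
  refine ⟨Nat.find hx', h1, ?_⟩
  rcases h : Nat.find hx' with _ | L
  · rw [h] at h1
    exact absurd h1.2 (by simp [P.mem_zero])
  · rw [h] at h1
    have h2 : x ∉ P.stage n L := Nat.find_min hx' (by omega)
    have h3 : P.mem n L (digits L x) = false := by
      by_contra hc
      exact h2 ⟨h1.1, by simpa using hc⟩
    have h4 : P.mem n (L + 1) (digits (L + 1) x) = true := h1.2
    simp [maximal, digits_succ_div_two, h3, h4]

/-- Intervals in a set of measure at most `2^{-k}` have level at least `k`. -/
theorem le_level {n k L : ℕ} {x : ℝ} (hx : x ∈ P.stage n L)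
    (h : volume.real (⋃ s, P.stage n s) ≤ (1 / 2) ^ k) : k ≤ L := by
  have h1 := (P.volume_stage_le n L).trans h
  rw [volume_stage, one_div_pow] at h1
  -- The stage contains x, hence a whole interval of measure 2^{-L}.
  have h2 : 0 < P.num n L :=
    Nat.pos_of_ne_zero (Nat.count_ne_iff_exists.2 ⟨_, digits_lt hx.1, hx.2⟩)
  have h3 : (1 : ℝ) ≤ P.num n L := by exact_mod_cast h2
  have h4 : (1 : ℝ) / 2 ^ L ≤ 1 / 2 ^ k := (by gcongr : (1 : ℝ) / 2 ^ L ≤ _).trans h1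
  rw [one_div_le_one_div (by positivity) (by positivity)] at h4
  exact (pow_le_pow_iff_right₀ (by norm_num)).1 h4

end IntervalFamily

theorem exists_intervalFamily {W : Set (ℕ × List Bool)} (hW : REPred fun p => p ∈ W) :
    ∃ P : IntervalFamily, ∀ n, testSet W n = ⋃ s, P.stage n s := by
  obtain ⟨P, h1, h2, h3, h4⟩ := exists_decidable_intervals hW
  refine ⟨⟨P, h1, h2, h3⟩, fun n => Set.ext fun x => ?_⟩
  simp only [h4, Set.mem_iUnion, IntervalFamily.stage, levelSet, Set.mem_ofPred_eq]
  exact exists_and_left.symm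

/-- A computable relation `c` assigning to the `i`-th dyadic interval of level `l + K` dyadic
intervals of level `l`, all of which meet a neighbourhood of `y l i / 2 ^ l`. -/
structure IntervalMap (K : ℕ) where
  rel : ℕ → ℕ → ℕ → Bool
  computable_rel : Computable fun q : ℕ × ℕ × ℕ => rel q.1 q.2.1 q.2.2
  center : ℕ → ℕ → ℝ
  rel_close : ∀ l i v, rel l i v = true → center l i < v + 1 ∧ (v : ℝ) ≤ center l i + 1

/-! ### Images of tests under interval maps -/

namespace IntervalMap

variable {K : ℕ} (F : IntervalMap K) (P : IntervalFamily)

/-- The images of the maximal intervals of a family, with the index of the family shifted so that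
the images have small measure. -/
def image (n l v : ℕ) : Bool :=
  decide (∃ i < 2 ^ (l + K), (P.maximal (n + K + 2) (l + K) i && F.rel l i v) = true)

/-- The intervals of level `s` that are contained in an image of level at most `s`. -/
def imageUpTo (n s j : ℕ) : Bool :=
  decide (∃ l < s + 1, F.image P n l (j / 2 ^ (s - l)) = true)

/-- The part of the `n`-th image that consists of intervals of level at most `s`. -/
def imageStage (n s : ℕ) : Set ℝ := levelSet s (F.imageUpTo P n s)

/-- The image of a family as a set of strings. -/
def imageTest : Set (ℕ × List Bool) := {p | F.image P p.1 p.2.length (strVal p.2) = true}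

theorem computable_image : Computable fun q : ℕ × ℕ × ℕ => F.image P q.1 q.2.1 q.2.2 := by
  have hl : Computable fun z : (ℕ × ℕ × ℕ) × ℕ => z.1.2.1 :=
    Computable.fst.comp (Computable.snd.comp Computable.fst)
  have hn : Computable fun z : (ℕ × ℕ × ℕ) × ℕ => z.1.1 + K + 2 :=
    Computable.natAdd (Computable.natAdd (Computable.fst.comp Computable.fst)
      (Computable.const K)) (Computable.const 2)
  have h : Computable₂ fun (q : ℕ × ℕ × ℕ) (i : ℕ) =>
      P.maximal (q.1 + K + 2) (q.2.1 + K) i && F.rel q.2.1 i q.2.2 :=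
    Computable.boolAnd
      (Computable.comp₃ P.computable_maximal hn (Computable.natAdd hl (Computable.const K))
        Computable.snd)
      (Computable.comp₃ F.computable_rel hl Computable.snd
        (Computable.snd.comp (Computable.snd.comp Computable.fst)))
  exact Computable.existsLt h (Computable.twoPow
    (Computable.natAdd (Computable.fst.comp Computable.snd) (Computable.const K)))

theorem computable_imageUpTo :
    Computable fun q : ℕ × ℕ × ℕ => F.imageUpTo P q.1 q.2.1 q.2.2 := by
  have h : Computable₂ fun (q : ℕ × ℕ × ℕ) (l : ℕ) =>
      F.image P q.1 l (q.2.2 / 2 ^ (q.2.1 - l)) :=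
    Computable.comp₃ (F.computable_image P) (Computable.fst.comp Computable.fst) Computable.snd
      (Computable.natDiv (Computable.snd.comp (Computable.snd.comp Computable.fst))
        (Computable.twoPow (Computable.natSub
          (Computable.fst.comp (Computable.snd.comp Computable.fst)) Computable.snd)))
  exact Computable.existsLt h
    (Computable.natAdd (Computable.fst.comp Computable.snd) (Computable.const 1))

theorem computable_count_imageUpTo : Computable₂ fun n s =>
    Nat.count (fun j => F.imageUpTo P n s j = true) (2 ^ s) := by
  have h : Computable₂ fun (q : ℕ × ℕ) (j : ℕ) => F.imageUpTo P q.1 q.2 j :=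
    Computable.comp₃ (F.computable_imageUpTo P) (Computable.fst.comp Computable.fst)
      (Computable.snd.comp Computable.fst) Computable.snd
  exact Computable.count h (Computable.twoPow Computable.snd)

/-- The level of an image fixes the level of its preimages, so the search for one is bounded and
membership is even decidable. -/
theorem re_imageTest : REPred fun p => p ∈ F.imageTest P := by
  have h : Computable fun p : ℕ × List Bool => F.image P p.1 p.2.length (strVal p.2) :=
    Computable.comp₃ (F.computable_image P) Computable.fst
      (Computable.list_length.comp Computable.snd) (computable_strVal.comp Computable.snd)
  exact (ComputablePred.computable_iff.2 ⟨_, h, rfl⟩).to_re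

theorem mem_imageStage_iff {n s : ℕ} {z : ℝ} : z ∈ F.imageStage P n s ↔
    z ∈ Set.Ico (0 : ℝ) 1 ∧ ∃ l ≤ s, F.image P n l (digits l z) = true := by
  simp only [imageStage, levelSet, imageUpTo, Set.mem_ofPred_eq, decide_eq_true_eq,
    Nat.lt_succ_iff]
  refine and_congr_right fun _ => exists_congr fun l => and_congr_right fun hl => ?_
  rw [digits_div hl]

theorem mem_testSet_imageTest_iff {n : ℕ} {z : ℝ} : z ∈ testSet (F.imageTest P) n ↔
    z ∈ Set.Ico (0 : ℝ) 1 ∧ ∃ l, F.image P n l (digits l z) = true := by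
  rw [mem_testSet_iff]
  refine and_congr_right fun hz => ⟨?_, ?_⟩
  · rintro ⟨σ, h, hσ⟩
    exact ⟨σ.length, by rw [hσ]; exact h⟩
  · rintro ⟨l, h⟩
    obtain ⟨σ, rfl, hσ⟩ := exists_strVal_eq (digits_lt (L := l) hz)
    refine ⟨σ, ?_, hσ.symm⟩
    rw [← hσ] at h
    exact h

theorem testSet_imageTest (n : ℕ) : testSet (F.imageTest P) n = ⋃ s, F.imageStage P n s := by
  ext z
  simp only [mem_testSet_imageTest_iff, Set.mem_iUnion, mem_imageStage_iff, exists_and_left]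
  refine and_congr_right fun _ => ⟨?_, ?_⟩
  · rintro ⟨l, h⟩
    exact ⟨l, l, le_rfl, h⟩
  · rintro ⟨_, l, -, h⟩
    exact ⟨l, h⟩

theorem monotone_imageStage (n : ℕ) : Monotone (F.imageStage P n) := by
  intro s t hst z
  simp only [mem_imageStage_iff]
  rintro ⟨h1, l, h2, h3⟩
  exact ⟨h1, l, h2.trans hst, h3⟩

theorem imageStage_subset (n s : ℕ) : F.imageStage P n s ⊆ Set.Ico 0 1 := fun _ hx => hx.1

/-- Related intervals lie between `center - 1` and `center + 2` in units of 2^{-l}. The length 3 is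
rounded up to a power of two. -/
theorem volume_rel_le (l i : ℕ) : volume.real (levelSet l (F.rel l i)) ≤ 4 / 2 ^ l := by
  have h : levelSet l (F.rel l i) ⊆
      Set.Ico ((F.center l i - 1) / 2 ^ l) ((F.center l i + 2) / 2 ^ l) := by
    rintro z ⟨hz, hr⟩
    obtain ⟨h1, h2⟩ := F.rel_close _ _ _ hr
    have h3 := (digits_eq_iff (L := l) hz.1).1 rfl
    constructor
    · exact (div_le_div_of_nonneg_right (by linarith) (by positivity)).trans h3.1
    · exact h3.2.trans_le (div_le_div_of_nonneg_right (by linarith) (by positivity))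
  refine (measureReal_mono h (by simp)).trans ?_
  rw [Real.volume_real_Ico_of_le (div_le_div_of_nonneg_right (by linarith) (by positivity)),
    ← sub_div]
  exact div_le_div_of_nonneg_right (by linarith) (by positivity)

/-- Each preimage has measure 2^{-(l+K)} and an image of measure at most 4·2^{-l}, which gives the
ratio 2^{K+2}. -/
theorem volume_image_le (n l : ℕ) : volume.real (levelSet l (F.image P n l)) ≤
    2 ^ (K + 2) * ((Nat.count (fun i => P.maximal (n + K + 2) (l + K) i = true)
      (2 ^ (l + K)) : ℝ) / 2 ^ (l + K)) := by
  have h : levelSet l (F.image P n l) ⊆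
      ⋃ i ∈ (Finset.range (2 ^ (l + K))).filter fun i => P.maximal (n + K + 2) (l + K) i = true,
        levelSet l (F.rel l i) := by
    rintro z ⟨hz, hr⟩
    simp only [image, decide_eq_true_eq, Bool.and_eq_true] at hr
    obtain ⟨i, hi, hm, hr⟩ := hr
    simp only [Set.mem_iUnion, Finset.mem_filter, Finset.mem_range]
    exact ⟨i, ⟨hi, hm⟩, hz, hr⟩
  refine (measureReal_mono h (volume_ne_top_of_subset_unit
    (Set.iUnion₂_subset fun _ _ => subset_unit_of_levelSet _ _))).trans ?_
  refine (measureReal_biUnion_finset_le _ _).trans ?_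
  refine (Finset.sum_le_sum fun i _ => F.volume_rel_le l i).trans ?_
  have e : (2 : ℝ) ^ (l + K) = 2 ^ l * 2 ^ K := pow_add 2 l K
  rw [Finset.sum_const, nsmul_eq_mul, Nat.count_eq_card_filter_range, e, pow_add 2 K 2]
  refine le_of_eq ?_
  field_simp
  norm_num

/-- New points come from maximal intervals of level s + 1 + K, whose total measure is the increment
of the family's stage. -/
theorem volume_imageStage_succ_le (n s : ℕ) : volume.real (F.imageStage P n (s + 1)) ≤
    volume.real (F.imageStage P n s) + 2 ^ (K + 2) *
      (volume.real (P.stage (n + K + 2) (s + 1 + K)) -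
        volume.real (P.stage (n + K + 2) (s + K))) := by
  have h : F.imageStage P n (s + 1) ⊆
      F.imageStage P n s ∪ levelSet (s + 1) (F.image P n (s + 1)) := by
    intro z hz
    obtain ⟨h1, l, h2, h3⟩ := (F.mem_imageStage_iff P).1 hz
    rcases Nat.le_succ_iff.1 h2 with h2 | rfl
    · exact Or.inl ((F.mem_imageStage_iff P).2 ⟨h1, l, h2, h3⟩)
    · exact Or.inr ⟨h1, h3⟩
  refine (measureReal_mono h (volume_ne_top_of_subset_unit (Set.union_subset
    (F.imageStage_subset P _ _) (subset_unit_of_levelSet _ _)))).trans ?_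
  refine (measureReal_union_le _ _).trans ?_
  have h2 := F.volume_image_le P n (s + 1)
  rw [show s + 1 + K = s + K + 1 by omega, P.count_maximal_succ] at h2
  rw [show s + 1 + K = s + K + 1 by omega]
  linarith

theorem volume_imageStage_le_add (n : ℕ) {s t : ℕ} (hst : s ≤ t) :
    volume.real (F.imageStage P n t) ≤ volume.real (F.imageStage P n s) + 2 ^ (K + 2) *
      (volume.real (P.stage (n + K + 2) (t + K)) -
        volume.real (P.stage (n + K + 2) (s + K))) := by
  induction t, hst using Nat.le_induction with
  | base => simp
  | succ t _ ih =>
    have := F.volume_imageStage_succ_le P n t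
    linarith

theorem volume_imageStage_zero_le (n : ℕ) : volume.real (F.imageStage P n 0) ≤
    2 ^ (K + 2) * volume.real (P.stage (n + K + 2) (0 + K)) := by
  have h : F.imageStage P n 0 ⊆ levelSet 0 (F.image P n 0) := by
    intro z hz
    obtain ⟨h1, l, h2, h3⟩ := (F.mem_imageStage_iff P).1 hz
    obtain rfl := Nat.le_zero.1 h2
    exact ⟨h1, h3⟩
  refine (measureReal_mono h (volume_ne_top_of_subset_unit
    (subset_unit_of_levelSet _ _))).trans ?_
  refine (F.volume_image_le P n 0).trans ?_
  gcongr
  exact P.count_maximal_le _ _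

theorem volume_imageStage_le (n s : ℕ) : volume.real (F.imageStage P n s) ≤
    volume.real (testSet (F.imageTest P) n) := by
  rw [testSet_imageTest]
  exact measureReal_mono (Set.subset_iUnion _ _)
    (volume_ne_top_of_subset_unit (Set.iUnion_subset (F.imageStage_subset P n)))

/-- The limit t → ∞ of the telescoped bound: the tail of the image is controlled by the tail of the
family. -/
theorem volume_testSet_imageTest_le_add (n s : ℕ) :
    volume.real (testSet (F.imageTest P) n) ≤ volume.real (F.imageStage P n s) +
      2 ^ (K + 2) * (volume.real (⋃ t, P.stage (n + K + 2) t) -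
        volume.real (P.stage (n + K + 2) (s + K))) := by
  rw [testSet_imageTest]
  refine le_of_tendsto (tendsto_volume_iUnion (F.monotone_imageStage P n)
    (F.imageStage_subset P n)) (eventually_atTop.2 ⟨s, fun t hst => ?_⟩)
  refine (F.volume_imageStage_le_add P n hst).trans ?_
  have := P.volume_stage_le (n + K + 2) (t + K)
  gcongr

theorem volume_testSet_imageTest_le (n : ℕ) : volume.real (testSet (F.imageTest P) n) ≤
    2 ^ (K + 2) * volume.real (⋃ t, P.stage (n + K + 2) t) := by
  -- The bound on stage 0 cancels the subtracted measure of level K.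
  have h1 := F.volume_testSet_imageTest_le_add P n 0
  have h2 := F.volume_imageStage_zero_le P n
  linarith

/-- If `x` lies in every member of the family and the maximal intervals around `x` are mapped to
intervals around `z`, then `z` lies in every member of the image. -/
theorem mem_testSet_imageTest {x z : ℝ} (hz : z ∈ Set.Ico (0 : ℝ) 1)
    (hP : ∀ n, volume.real (⋃ s, P.stage n s) ≤ (1 / 2) ^ n) (hx : ∀ n, x ∈ ⋃ s, P.stage n s)
    (hxz : ∀ l, F.rel l (digits (l + K) x) (digits l z) = true) (n : ℕ) :
    z ∈ testSet (F.imageTest P) n := by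
  obtain ⟨L, h1, h2⟩ := P.exists_maximal (hx (n + K + 2))
  -- Intervals of level below K have no image, but the measure bound forces L ≥ n + K + 2.
  obtain ⟨l, rfl⟩ : ∃ l, L = l + K :=
    ⟨L - K, by have := P.le_level h1 (hP _); omega⟩
  refine (F.mem_testSet_imageTest_iff P).2 ⟨hz, l, ?_⟩
  simp only [image, decide_eq_true_eq, Bool.and_eq_true]
  exact ⟨_, digits_lt h1.1, h2, hxz l⟩

theorem uniformlyComputable_image
    (hP : UniformlyComputable fun n => volume.real (⋃ s, P.stage n s)) :
    UniformlyComputable fun n => volume.real (testSet (F.imageTest P) n) := by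
  obtain ⟨g, hg, hgP⟩ := hP
  -- With δ = 2^{-(k+K+5)}, this says that the δ-approximation of the measure exceeds the stage by
  -- at most 2δ, cleared of denominators. Truncating a negative approximation to 0 is harmless
  -- because measures are nonnegative.
  let S : ℕ × ℕ → ℕ → Prop := fun q s =>
    (g (q.1 + K + 2) (q.2 + K + 5)).toNat * 2 ^ (s + K) ≤
      P.num (q.1 + K + 2) (s + K) * 2 ^ (q.2 + K + 5) + 2 * 2 ^ (s + K)
  have hS : ∀ q s, S q s ↔ ((g (q.1 + K + 2) (q.2 + K + 5)).toNat : ℝ) / 2 ^ (q.2 + K + 5) ≤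
      volume.real (P.stage (q.1 + K + 2) (s + K)) + 2 * (1 / 2) ^ (q.2 + K + 5) := by
    intro q s
    simp only [S]
    rw [P.volume_stage, one_div_pow, ← Nat.cast_le (α := ℝ)]
    push_cast
    have h1 : (0 : ℝ) < 2 ^ (q.2 + K + 5) := by positivity
    have h2 : (0 : ℝ) < 2 ^ (s + K) := by positivity
    rw [div_le_iff₀ h1]
    generalize (2 : ℝ) ^ (q.2 + K + 5) = a at *
    generalize (2 : ℝ) ^ (s + K) = b at *
    refine Iff.trans ?_ (mul_le_mul_iff_of_pos_right h2)
    have : ((P.num (q.1 + K + 2) (s + K) : ℝ) / b + 2 * (1 / a)) * a * b =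
        P.num (q.1 + K + 2) (s + K) * a + 2 * b := by field_simp
    rw [this]
  -- The search halts: the stages come within δ of the measure, which is within δ of its
  -- approximation.
  have hex : ∀ q, ∃ s, S q s := by
    intro q
    have hlim := (tendsto_volume_iUnion (P.monotone_stage (q.1 + K + 2))
      (P.stage_subset (q.1 + K + 2))).comp (tendsto_add_atTop_nat K)
    have hb := hgP (q.1 + K + 2) (q.2 + K + 5)
    have hpos : (0 : ℝ) < (1 / 2) ^ (q.2 + K + 5) := by positivity
    obtain ⟨s, hs⟩ := (hlim.eventually (lt_mem_nhds (sub_lt_self _ hpos))).exists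
    refine ⟨s, (hS q s).2 ?_⟩
    simp only [Function.comp_apply] at hs
    have h0 : (0 : ℝ) ≤ volume.real (P.stage (q.1 + K + 2) (s + K)) := measureReal_nonneg
    rcases le_total 0 (g (q.1 + K + 2) (q.2 + K + 5)) with h | h
    · have hc : ((g (q.1 + K + 2) (q.2 + K + 5)).toNat : ℝ) = g (q.1 + K + 2) (q.2 + K + 5) := by
        exact_mod_cast Int.toNat_of_nonneg h
      rw [hc]
      linarith [(abs_le.1 hb).1]
    · rw [Int.toNat_of_nonpos h]
      simp only [Nat.cast_zero, zero_div]
      positivity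
  have hScomp : ComputablePred fun p : (ℕ × ℕ) × ℕ => S p.1 p.2 := by
    have hn : Computable fun p : (ℕ × ℕ) × ℕ => p.1.1 + K + 2 :=
      Computable.natAdd (Computable.natAdd (Computable.fst.comp Computable.fst)
        (Computable.const K)) (Computable.const 2)
    have hk : Computable fun p : (ℕ × ℕ) × ℕ => p.1.2 + K + 5 :=
      Computable.natAdd (Computable.natAdd (Computable.snd.comp Computable.fst)
        (Computable.const K)) (Computable.const 5)
    have hs : Computable fun p : (ℕ × ℕ) × ℕ => p.2 + K :=
      Computable.natAdd Computable.snd (Computable.const K)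
    refine Computable.computablePred (Computable.decideLe ?_ ?_)
    · exact Computable.natMul (primrec_int_toNat.to_comp.comp (hg.comp hn hk))
        (Computable.twoPow hs)
    · exact Computable.natAdd (Computable.natMul (P.computable_num.comp hn hs)
        (Computable.twoPow hk)) (Computable.natMul (Computable.const 2) (Computable.twoPow hs))
  have hfind : Computable fun q : ℕ × ℕ => Nat.find (hex q) := Computable.find hScomp hex
  refine uniformlyComputable_of_approx
    (N := fun n k => Nat.count (fun j => F.imageUpTo P n (Nat.find (hex (n, k))) j = true)
      (2 ^ Nat.find (hex (n, k)))) (lev := fun n k => Nat.find (hex (n, k)))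
    ((F.computable_count_imageUpTo P).comp Computable.fst hfind) hfind fun n k => ?_
  have hs := (hS _ _).1 (Nat.find_spec (hex (n, k)))
  generalize Nat.find (hex (n, k)) = s at *
  rw [← volume_levelSet]
  refine ⟨F.volume_imageStage_le P n s, (F.volume_testSet_imageTest_le_add P n s).trans ?_⟩
  have hb := (abs_le.1 (hgP (n + K + 2) (k + K + 5))).2
  simp only at hs
  have hc : (g (n + K + 2) (k + K + 5) : ℝ) / 2 ^ (k + K + 5) ≤
      ((g (n + K + 2) (k + K + 5)).toNat : ℝ) / 2 ^ (k + K + 5) := by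
    gcongr
    exact_mod_cast Int.self_le_toNat _
  -- The search allows 2δ and the approximation δ. The total is rounded up to 4δ, so that the factor
  -- 2^{K+2} turns it into 2^{-(k+1)}.
  have hd : volume.real (⋃ t, P.stage (n + K + 2) t) -
      volume.real (P.stage (n + K + 2) (s + K)) ≤ 4 * (1 / 2) ^ (k + K + 5) := by
    have : (0 : ℝ) < (1 / 2) ^ (k + K + 5) := by positivity
    linarith
  have he : (2 : ℝ) ^ (K + 2) * (4 * (1 / 2) ^ (k + K + 5)) = (1 / 2) ^ (k + 1) := by
    rw [one_div_pow, one_div_pow, pow_add 2 K 2, show k + K + 5 = (k + 1) + K + 4 by omega,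
      pow_add 2 _ 4, pow_add 2 _ K]
    field_simp
    norm_num
  have := mul_le_mul_of_nonneg_left hd (by positivity : (0 : ℝ) ≤ 2 ^ (K + 2))
  change volume.real (F.imageStage P n s) + _ ≤ volume.real (F.imageStage P n s) + _
  linarith

end IntervalMap

/-- Schnorr tests can be transported along interval maps. -/
theorem IntervalMap.exists_schnorrTest {K : ℕ} (F : IntervalMap K) {W : Set (ℕ × List Bool)}
    (hW : IsSchnorrTest W) : ∃ W', IsSchnorrTest W' ∧ ∀ x z : ℝ, z ∈ Set.Ico (0 : ℝ) 1 →
      (∀ n, x ∈ testSet W n) → (∀ l, F.rel l (digits (l + K) x) (digits l z) = true) →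
      ∀ n, z ∈ testSet W' n := by
  obtain ⟨P, hP⟩ := exists_intervalFamily hW.re
  have hle : ∀ n, volume.real (⋃ s, P.stage n s) ≤ (1 / 2) ^ n := fun n => by
    rw [← hP]
    exact hW.measure_le n
  refine ⟨F.imageTest P, ⟨⟨F.re_imageTest P, fun n => ?_⟩, ?_⟩, fun x z hz hx hxz =>
    F.mem_testSet_imageTest P hz hle (fun n => hP n ▸ hx n) hxz⟩
  · refine (F.volume_testSet_imageTest_le P n).trans ?_
    refine (mul_le_mul_of_nonneg_left (hle _) (by positivity)).trans (le_of_eq ?_)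
    rw [one_div_pow, one_div_pow, show n + K + 2 = n + (K + 2) by omega, pow_add 2 n]
    field_simp
  · refine F.uniformlyComputable_image P ?_
    have := hW.measure_computable
    simp only [hP] at this
    exact this

/-! ### The interval map induced by the reduction -/

section Translation

variable (f : ℚ → ℚ) (M N : ℤ) (K : ℕ)

/-- The numerator, over the denominator `2 ^ (l + K)`, of the left neighbour of the `i`-th dyadic
point of level `l + K`, translated by `N`. -/
def leftNeighbour (l i : ℕ) : ℤ :=
  ((N.toNat * 2 ^ (l + K) + i : ℕ) : ℤ) - (((-N).toNat * 2 ^ (l + K) + 1 : ℕ) : ℤ)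

/-- The value of `f` at the left neighbour of a dyadic point. -/
def valueAt (l i : ℕ) : ℚ := f ((leftNeighbour N K l i : ℚ) / ((2 ^ (l + K) : ℕ) : ℚ))

/-- The positive part of the numerator of `2 ^ l * (valueAt f N K l i - M)`. -/
def posPart (l i : ℕ) : ℕ :=
  (valueAt f N K l i).num.toNat * 2 ^ l + (-M).toNat * 2 ^ l * (valueAt f N K l i).den

/-- The negative part of the numerator of `2 ^ l * (valueAt f N K l i - M)`. -/
def negPart (l i : ℕ) : ℕ :=
  (-(valueAt f N K l i).num).toNat * 2 ^ l + M.toNat * 2 ^ l * (valueAt f N K l i).den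

theorem leftNeighbour_eq (l i : ℕ) : leftNeighbour N K l i = N * 2 ^ (l + K) + i - 1 := by
  have : (N.toNat : ℤ) - ((-N).toNat : ℤ) = N := Int.toNat_sub_toNat_neg N
  rw [leftNeighbour]
  push_cast
  linear_combination this * 2 ^ (l + K)

theorem cast_toNat_sub (z : ℤ) : (z.toNat : ℝ) - ((-z).toNat : ℝ) = z := by
  exact_mod_cast congrArg (Int.cast : ℤ → ℝ) (Int.toNat_sub_toNat_neg z)

/-- Multiplying by the denominator and moving negative terms across turns rational comparisons with
the centre into comparisons of natural numbers. -/
theorem posPart_sub_negPart (l i : ℕ) : (posPart f M N K l i : ℝ) - negPart f M N K l i =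
    ((valueAt f N K l i : ℝ) - M) * 2 ^ l * (valueAt f N K l i).den := by
  have h1 := cast_toNat_sub (valueAt f N K l i).num
  have h2 := cast_toNat_sub M
  have h3 : (valueAt f N K l i : ℝ) * (valueAt f N K l i).den = (valueAt f N K l i).num := by
    exact_mod_cast congrArg (Rat.cast : ℚ → ℝ) (Rat.mul_den_eq_num (valueAt f N K l i))
  rw [posPart, negPart]
  push_cast
  linear_combination h1 * 2 ^ l - h2 * 2 ^ l * (valueAt f N K l i).den - h3 * 2 ^ l

variable {f} in
theorem computable_valueAt (hf : ComputableRatFun f) : Computable fun q : ℕ × ℕ × ℕ =>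
    ((valueAt f N K q.1 q.2.1).num, (valueAt f N K q.1 q.2.1).den) := by
  have hp : Computable fun q : ℕ × ℕ × ℕ => 2 ^ (q.1 + K) :=
    Computable.twoPow (Computable.natAdd Computable.fst (Computable.const K))
  have h1 : Computable fun q : ℕ × ℕ × ℕ => N.toNat * 2 ^ (q.1 + K) + q.2.1 :=
    Computable.natAdd (Computable.natMul (Computable.const _) hp)
      (Computable.fst.comp Computable.snd)
  have h2 : Computable fun q : ℕ × ℕ × ℕ => (-N).toNat * 2 ^ (q.1 + K) + 1 :=
    Computable.natAdd (Computable.natMul (Computable.const _) hp) (Computable.const 1)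
  have hl : Computable fun q : ℕ × ℕ × ℕ => leftNeighbour N K q.1 q.2.1 := by
    simp only [leftNeighbour]
    exact Computable.intSub h1 h2
  simp only [valueAt]
  exact Computable.comp (g := fun q : ℕ × ℕ × ℕ => (leftNeighbour N K q.1 q.2.1, 2 ^ (q.1 + K)))
    (f := fun p : ℤ × ℕ => ((f ((p.1 : ℚ) / (p.2 : ℚ))).num, (f ((p.1 : ℚ) / (p.2 : ℚ))).den))
    hf (hl.pair hp)

/-- The interval map that sends the dyadic interval with left end point `x` and length `ε` to the
dyadic intervals near `f (x - ε)`, up to integer translations. -/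
noncomputable def translationMap (hf : ComputableRatFun f) : IntervalMap K where
  rel l i v :=
    decide (posPart f M N K l i < (v + 1) * (valueAt f N K l i).den + negPart f M N K l i) &&
      decide (v * (valueAt f N K l i).den + negPart f M N K l i ≤
        posPart f M N K l i + (valueAt f N K l i).den)
  computable_rel := by
    have hv := computable_valueAt N K hf
    have hnum : Computable fun q : ℕ × ℕ × ℕ => (valueAt f N K q.1 q.2.1).num :=
      Computable.fst.comp hv
    have hden : Computable fun q : ℕ × ℕ × ℕ => (valueAt f N K q.1 q.2.1).den :=
      Computable.snd.comp hv
    have hpow : Computable fun q : ℕ × ℕ × ℕ => 2 ^ q.1 := Computable.twoPow Computable.fst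
    have hpos : Computable fun q : ℕ × ℕ × ℕ => posPart f M N K q.1 q.2.1 :=
      Computable.natAdd (Computable.natMul (primrec_int_toNat.to_comp.comp hnum) hpow)
        (Computable.natMul (Computable.natMul (Computable.const (-M).toNat) hpow) hden)
    have hneg : Computable fun q : ℕ × ℕ × ℕ => negPart f M N K q.1 q.2.1 :=
      Computable.natAdd (Computable.natMul (primrec_int_neg_toNat.to_comp.comp hnum) hpow)
        (Computable.natMul (Computable.natMul (Computable.const M.toNat) hpow) hden)
    have hi : Computable fun q : ℕ × ℕ × ℕ => q.2.2 := Computable.snd.comp Computable.snd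
    exact Computable.boolAnd
      (Computable.decideLt hpos (Computable.natAdd (Computable.natMul
        (Computable.natAdd hi (Computable.const 1)) hden) hneg))
      (Computable.decideLe (Computable.natAdd (Computable.natMul hi hden) hneg)
        (Computable.natAdd hpos hden))
  center l i := ((valueAt f N K l i : ℝ) - M) * 2 ^ l
  rel_close l i v h := by
    simp only [Bool.and_eq_true, decide_eq_true_eq] at h
    have hd : (0 : ℝ) < (valueAt f N K l i).den := by exact_mod_cast (valueAt f N K l i).den_pos
    have h0 := posPart_sub_negPart f M N K l i
    have h1 : (posPart f M N K l i : ℝ) <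
        (v + 1) * (valueAt f N K l i).den + negPart f M N K l i := by exact_mod_cast h.1
    have h2 : (v : ℝ) * (valueAt f N K l i).den + negPart f M N K l i ≤
        posPart f M N K l i + (valueAt f N K l i).den := by exact_mod_cast h.2
    constructor
    · refine lt_of_mul_lt_mul_right ?_ hd.le
      linarith
    · refine le_of_mul_le_mul_right ?_ hd
      linarith

variable {f M N K} in
theorem translationMap_rel {hf : ComputableRatFun f} {l i v : ℕ}
    (h1 : ((valueAt f N K l i : ℝ) - M) * 2 ^ l < v + 1)
    (h2 : (v : ℝ) ≤ ((valueAt f N K l i : ℝ) - M) * 2 ^ l + 1) :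
    (translationMap f M N K hf).rel l i v = true := by
  have hd : (0 : ℝ) < (valueAt f N K l i).den := by exact_mod_cast (valueAt f N K l i).den_pos
  have h0 := posPart_sub_negPart f M N K l i
  have h1' := mul_lt_mul_of_pos_right h1 hd
  have h2' := mul_le_mul_of_nonneg_right h2 hd.le
  simp only [translationMap, Bool.and_eq_true, decide_eq_true_eq]
  constructor
  · rw [← Nat.cast_lt (α := ℝ)]
    push_cast
    linarith
  · rw [← Nat.cast_le (α := ℝ)]
    push_cast
    linarith

end Translation

/-- Schnorr randomness is closed upwards under total Solovay reducibility. -/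
theorem IsSchnorrRandom.of_totalSolovayReducible {α β : ℝ} (hrand : IsSchnorrRandom α)
    (hred : TotalSolovayReducible α β) : IsSchnorrRandom β := by
  obtain ⟨c, hc, f, hf, hfβ⟩ := hred
  -- With 2c < 2^K, an error of c·2·2^{-(l+K)} stays below 2^{-l}.
  obtain ⟨K, hK⟩ := pow_unbounded_of_one_lt (2 * (c : ℝ)) one_lt_two
  intro W hW
  by_contra! hβ
  -- Tests see only fractional parts, while f acts on the reals themselves; the two integer parts
  -- are fixed constants of the map.
  obtain ⟨W', hW', h⟩ := (translationMap f ⌊α⌋ ⌊β⌋ K hf).exists_schnorrTest hW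
  obtain ⟨n, hn⟩ := hrand W' hW'
  refine hn (h (Int.fract β) (Int.fract α) ⟨Int.fract_nonneg α, Int.fract_lt_one α⟩ hβ
    (fun l => ?_) n)
  set i := digits (l + K) (Int.fract β) with hi
  have hlK : (0 : ℝ) < 2 ^ (l + K) := by positivity
  have hl : (0 : ℝ) < 2 ^ l := by positivity
  have hβi := (digits_eq_iff (Int.fract_nonneg β)).1 hi.symm
  rw [Set.mem_Ico, div_le_iff₀ hlK, lt_div_iff₀ hlK] at hβi
  -- β may be the left end point of its interval, and f is controlled only strictly below β; hence
  -- the shift by one more interval.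
  set q : ℚ := (leftNeighbour ⌊β⌋ K l i : ℚ) / ((2 ^ (l + K) : ℕ) : ℚ) with hq
  have hq' : (q : ℝ) * 2 ^ (l + K) = ⌊β⌋ * 2 ^ (l + K) + i - 1 := by
    rw [hq, leftNeighbour_eq]
    push_cast
    field_simp
  have hβf : Int.fract β = β - ⌊β⌋ := rfl
  have hαf : Int.fract α = α - ⌊α⌋ := rfl
  rw [hβf] at hβi
  have hqβ : (q : ℝ) < β := by
    refine lt_of_mul_lt_mul_right ?_ hlK.le
    linarith [hβi.1]
  have hβq : (β - q) * 2 ^ (l + K) < 2 := by linarith [hβi.2]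
  obtain ⟨h1, h2⟩ := hfβ q hqβ
  have hval : (valueAt f ⌊β⌋ K l i : ℝ) = f q := rfl
  have hc' : (0 : ℝ) < c := by exact_mod_cast hc
  have h3 : (α - f q) * 2 ^ l < 1 := by
    have e1 := mul_lt_mul_of_pos_right h2 hlK
    have e2 := mul_lt_mul_of_pos_left hβq hc'
    have e3 : (α - f q) * 2 ^ l * 2 ^ K < 1 * 2 ^ K := by
      rw [mul_assoc, ← pow_add]
      linarith
    exact lt_of_mul_lt_mul_right e3 (by positivity)
  have hα := (digits_eq_iff (L := l) (Int.fract_nonneg α)).1 rfl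
  rw [Set.mem_Ico, div_le_iff₀ hl, lt_div_iff₀ hl, hαf] at hα
  have h4 := mul_lt_mul_of_pos_right h1 hl
  -- If v is the level-l digit value of the fractional part of α, then f(q) < α puts the centre
  -- below v + 1, and `h3` puts it above v - 1.
  apply translationMap_rel <;> rw [hval, hαf] <;> linarith [hα.1, hα.2]

end TotalSolovay

theorem mainTheorem2 (α β : ℝ)
    (hα : TotalSolovay.IsLeftCE α)
    (hred : TotalSolovay.TotalSolovayReducible α β)
    (hrand : TotalSolovay.IsSchnorrRandom α) :
    TotalSolovay.IsSchnorrRandom β :=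
  hrand.of_totalSolovayReducible hred
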